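/- Let $(M,g,J,\kappa)$ be an almost Kähler manifold: $\kappa$ is a symplectic form on the smooth manifold $M$, $J$ is a smooth almost complex structure, and $g=\kappa(\cdot,J\cdot)$ is a Hermitian (Riemannian) metric. Let $\nabla$ be the Levi-Civita connection of $g$, and let $$R(X,Y,Z,W)=g(\nabla_X\nabla_YZ-\nabla_Y\nabla_XZ-\nabla_{[X,Y]}Z,\,W),$$ $$R^J(X,Y,Z,W)=g(\nabla_X(J\nabla_YZ)-\nabla_Y(J\nabla_XZ)-\nabla_{[X,Y]}(JZ),\,JW)$$ for smooth vector fields $X,Y,Z,W$; both are extended complex-multilinearly to smooth sections of $TM\otimes\mathbb C$. A complex vector field $Z$ is of type $(1,0)$ if $JZ=iZ$. If $$R^J(\overline{Z_i},Z_j,Z_i,\overline{Z_j})=R(\overline{Z_i},Z_j,Z_i,\overline{Z_j})$$ for all smooth complex vector fields $Z_i,Z_j$ of type $(1,0)$, then $J$ is integrable, i.e. its Nijenhuis tensor $$N_J(X,Y)=[JX,JY]-J[JX,Y]-J[X,JY]-[X,Y]$$ vanishes. Moreover, this hypothesis is equivalent to $$R^J(JX,Y,X,JY)=R(JX,Y,X,JY)$$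 for all smooth real vector fields $X,Y$. -/

import Mathlib

open Bundle VectorField NormedSpace
open scoped Manifold ContDiff

noncomputable section

namespace AlmostKahler

/-! `M` is a smooth manifold without boundary, modelled on a finite-dimensional real vector
space `E`.  (The dimension is even as soon as a nonempty `M` carries an almost complex structure.) -/

variable {E : Type*} [NormedAddCommGroup E] [NormedSpace ℝ E]
  {M : Type*} [TopologicalSpace M] [ChartedSpace E M]

variable (E M) in
/-- Real vector fields on `M` (no regularity built in). -/
abbrev VField : Type _ := Π x : M, TangentSpace 𝓘(ℝ, E) x

variable (E M) in
/-- Fields of endomorphisms of the tangent spaces. -/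
abbrev EndField : Type _ := Π x : M, TangentSpace 𝓘(ℝ, E) x →L[ℝ] TangentSpace 𝓘(ℝ, E) x

variable (E M) in
/-- Fields of real bilinear forms on the tangent spaces. -/
abbrev BilinField : Type _ := Π x : M, TangentSpace 𝓘(ℝ, E) x →L[ℝ] TangentSpace 𝓘(ℝ, E) x →L[ℝ] ℝ

/-- `[X, Y]`. -/
def bracket (X Y : VField E M) : VField E M := mlieBracket 𝓘(ℝ, E) X Y

/-- The vector field `J X`. -/
def app (J : EndField E M) (X : VField E M) : VField E M := fun x ↦ J x (X x)

/-- The Nijenhuis tensor `N_J(X,Y) = [JX,JY] - J[JX,Y] - J[X,JY] - [X,Y]`. -/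
def nijenhuis (J : EndField E M) (X Y : VField E M) : VField E M :=
  bracket (app J X) (app J Y) - app J (bracket (app J X) Y) - app J (bracket X (app J Y))
    - bracket X Y

/-- The exterior derivative of a 2-form, by the invariant formula
`dκ(X,Y,Z) = X κ(Y,Z) - Y κ(X,Z) + Z κ(X,Y) - κ([X,Y],Z) + κ([X,Z],Y) - κ([Y,Z],X)`. -/
def extDeriv₂ (κ : BilinField E M) (X Y Z : VField E M) (x : M) : ℝ :=
  mvfderiv 𝓘(ℝ, E) (fun y ↦ κ y (Y y) (Z y)) x (X x)
    - mvfderiv 𝓘(ℝ, E) (fun y ↦ κ y (X y) (Z y)) x (Y x)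
    + mvfderiv 𝓘(ℝ, E) (fun y ↦ κ y (X y) (Y y)) x (Z x)
    - κ x (bracket X Y x) (Z x)
    + κ x (bracket X Z x) (Y x)
    - κ x (bracket Y Z x) (X x)

variable [IsManifold 𝓘(ℝ, E) ∞ M]

/-- A smooth real vector field: a smooth section of the tangent bundle. -/
def SmoothVF (X : VField E M) : Prop :=
  ContMDiff 𝓘(ℝ, E) 𝓘(ℝ, E).tangent ∞ (fun x ↦ (⟨x, X x⟩ : TangentBundle 𝓘(ℝ, E) M))

/-- An almost complex structure: a smooth section `J` of `End(TM)` with `J² = -Id`. -/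
structure IsAlmostComplex (J : EndField E M) : Prop where
  smooth : ContMDiff 𝓘(ℝ, E) (𝓘(ℝ, E).prod 𝓘(ℝ, E →L[ℝ] E)) ∞
    (fun x ↦ TotalSpace.mk' (E →L[ℝ] E)
      (E := fun x : M ↦ TangentSpace 𝓘(ℝ, E) x →L[ℝ] TangentSpace 𝓘(ℝ, E) x) x (J x))
  sq_eq_neg : ∀ (x : M) (v : TangentSpace 𝓘(ℝ, E) x), J x (J x v) = -v

/-- `J` is integrable if its Nijenhuis tensor vanishes. -/
def IsIntegrable (J : EndField E M) : Prop :=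
  ∀ X Y : VField E M, SmoothVF X → SmoothVF Y → ∀ x, nijenhuis J X Y x = 0

/-- A symplectic form: a smooth, closed, non-degenerate 2-form. -/
structure IsSymplectic (κ : BilinField E M) : Prop where
  smooth : ContMDiff 𝓘(ℝ, E) (𝓘(ℝ, E).prod 𝓘(ℝ, E →L[ℝ] E →L[ℝ] ℝ)) ∞
    (fun x ↦ TotalSpace.mk' (E →L[ℝ] E →L[ℝ] ℝ)
      (E := fun x : M ↦ TangentSpace 𝓘(ℝ, E) x →L[ℝ] TangentSpace 𝓘(ℝ, E) x →L[ℝ] ℝ) x (κ x))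
  alternating : ∀ (x : M) (v : TangentSpace 𝓘(ℝ, E) x), κ x v v = 0
  closed : ∀ X Y Z : VField E M, SmoothVF X → SmoothVF Y → SmoothVF Z →
    ∀ x, extDeriv₂ κ X Y Z x = 0
  nondegenerate : ∀ (x : M) (v : TangentSpace 𝓘(ℝ, E) x), (∀ w, κ x v w = 0) → v = 0

/-! ### Connections on the tangent bundle and complex vector fields -/

/-- `∇_X Y`. -/
def cov (nab : CovariantDerivative 𝓘(ℝ, E) E (fun x : M ↦ TangentSpace 𝓘(ℝ, E) x))
    (X Y : VField E M) : VField E M := fun x ↦ nab Y x (X x)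

variable (E M) in
/-- Complex vector fields on `M`, i.e. sections `re + i im` of `TM ⊗ ℂ = TM ⊕ i TM`. -/
@[ext]
structure CVField where
  /-- The real part. -/
  re : VField E M
  /-- The imaginary part. -/
  im : VField E M

namespace CVField

instance : Sub (CVField E M) := ⟨fun Z W ↦ ⟨Z.re - W.re, Z.im - W.im⟩⟩

/-- `(a + ib)(re + i im) = (a re - b im) + i (a im + b re)`. -/
instance : SMul ℂ (CVField E M) :=
  ⟨fun c Z ↦ ⟨c.re • Z.re - c.im • Z.im, c.re • Z.im + c.im • Z.re⟩⟩

/-- Smoothness of a complex vector field. -/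
def Smooth (Z : CVField E M) : Prop := SmoothVF Z.re ∧ SmoothVF Z.im

/-- The conjugate field. -/
def conj (Z : CVField E M) : CVField E M := ⟨Z.re, -Z.im⟩

/-- The complex-linear extension of an endomorphism field. -/
def app (J : EndField E M) (Z : CVField E M) : CVField E M :=
  ⟨AlmostKahler.app J Z.re, AlmostKahler.app J Z.im⟩

/-- `Z` is of type `(1,0)`: it lies in the `i`-eigenspace of `J`. -/
def IsType10 (J : EndField E M) (Z : CVField E M) : Prop := app J Z = Complex.I • Z

/-- The complex-bilinear extension of a connection. -/
def cov (nab : CovariantDerivative 𝓘(ℝ, E) E (fun x : M ↦ TangentSpace 𝓘(ℝ, E) x))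
    (Z W : CVField E M) : CVField E M :=
  ⟨AlmostKahler.cov nab Z.re W.re - AlmostKahler.cov nab Z.im W.im,
    AlmostKahler.cov nab Z.re W.im + AlmostKahler.cov nab Z.im W.re⟩

/-- The complex-bilinear extension of the Lie bracket. -/
def bracket (Z W : CVField E M) : CVField E M :=
  ⟨AlmostKahler.bracket Z.re W.re - AlmostKahler.bracket Z.im W.im,
    AlmostKahler.bracket Z.re W.im + AlmostKahler.bracket Z.im W.re⟩

end CVField

/-! ### Almost Kähler manifolds, the Levi-Civita connection and the curvature tensors -/

/-- The tensor `g(v, w) = κ(v, J w)`. -/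
def metric (κ : BilinField E M) (J : EndField E M) (x : M) (v w : TangentSpace 𝓘(ℝ, E) x) : ℝ :=
  κ x v (J x w)

/-- `(M, g, J, κ)` is an almost Kähler manifold: `κ` is symplectic, `J` is an almost complex
structure, and `J` is `κ`-calibrated, i.e. `g = κ(·, J·)` is a Hermitian metric. -/
structure IsAlmostKahler (κ : BilinField E M) (J : EndField E M) : Prop where
  symplectic : IsSymplectic κ
  almostComplex : IsAlmostComplex J
  symm : ∀ (x : M) (v w : TangentSpace 𝓘(ℝ, E) x), metric κ J x v w = metric κ J x w v
  pos : ∀ (x : M) (v : TangentSpace 𝓘(ℝ, E) x), v ≠ 0 → 0 < metric κ J x v v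
  hermitian : ∀ (x : M) (v w : TangentSpace 𝓘(ℝ, E) x),
    metric κ J x (J x v) (J x w) = metric κ J x v w

/-- `∇` is the Levi-Civita connection of `g = κ(·, J·)`: the smooth torsion-free connection on `TM`
with `X g(Y, Z) = g(∇_X Y, Z) + g(Y, ∇_X Z)`. -/
structure IsLeviCivita [FiniteDimensional ℝ E] (κ : BilinField E M) (J : EndField E M)
    (nab : CovariantDerivative 𝓘(ℝ, E) E (fun x : M ↦ TangentSpace 𝓘(ℝ, E) x)) : Prop where
  smooth : nab.ContMDiffCovariantDerivative ∞
  torsion_free : nab.torsion = 0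
  metric_compatible : ∀ (X Y Z : VField E M) (x : M),
    MDiffAt (T% Y) x → MDiffAt (T% Z) x →
    mvfderiv 𝓘(ℝ, E) (fun y ↦ metric κ J y (Y y) (Z y)) x (X x) =
      metric κ J x (cov nab X Y x) (Z x) + metric κ J x (Y x) (cov nab X Z x)

/-- The complex-bilinear extension of the metric `g = κ(·, J·)`. -/
def gC (κ : BilinField E M) (J : EndField E M) (Z W : CVField E M) (x : M) : ℂ :=
  ⟨metric κ J x (Z.re x) (W.re x) - metric κ J x (Z.im x) (W.im x),
    metric κ J x (Z.re x) (W.im x) + metric κ J x (Z.im x) (W.re x)⟩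

/-- `R(X,Y,Z,W) = g(∇_X ∇_Y Z - ∇_Y ∇_X Z - ∇_{[X,Y]} Z, W)` for real vector fields. -/
def curv (κ : BilinField E M) (J : EndField E M)
    (nab : CovariantDerivative 𝓘(ℝ, E) E (fun x : M ↦ TangentSpace 𝓘(ℝ, E) x))
    (X Y Z W : VField E M) (x : M) : ℝ :=
  metric κ J x ((cov nab X (cov nab Y Z) - cov nab Y (cov nab X Z) - cov nab (bracket X Y) Z) x)
    (W x)

/-- `R^J(X,Y,Z,W) = g(∇_X J∇_Y Z - ∇_Y J∇_X Z - ∇_{[X,Y]} JZ, JW)` for real vector fields. -/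
def curvJ (κ : BilinField E M) (J : EndField E M)
    (nab : CovariantDerivative 𝓘(ℝ, E) E (fun x : M ↦ TangentSpace 𝓘(ℝ, E) x))
    (X Y Z W : VField E M) (x : M) : ℝ :=
  metric κ J x ((cov nab X (app J (cov nab Y Z)) - cov nab Y (app J (cov nab X Z))
    - cov nab (bracket X Y) (app J Z)) x) (app J W x)

/-- `R(X,Y,Z,W) = g(∇_X ∇_Y Z - ∇_Y ∇_X Z - ∇_{[X,Y]} Z, W)` for complex vector fields. -/
def curvC (κ : BilinField E M) (J : EndField E M)
    (nab : CovariantDerivative 𝓘(ℝ, E) E (fun x : M ↦ TangentSpace 𝓘(ℝ, E) x))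
    (X Y Z W : CVField E M) (x : M) : ℂ :=
  gC κ J (.cov nab X (.cov nab Y Z) - .cov nab Y (.cov nab X Z) - .cov nab (.bracket X Y) Z) W x

/-- `R^J(X,Y,Z,W) = g(∇_X J∇_Y Z - ∇_Y J∇_X Z - ∇_{[X,Y]} JZ, JW)` for complex vector fields. -/
def curvJC (κ : BilinField E M) (J : EndField E M)
    (nab : CovariantDerivative 𝓘(ℝ, E) E (fun x : M ↦ TangentSpace 𝓘(ℝ, E) x))
    (X Y Z W : CVField E M) (x : M) : ℂ :=
  gC κ J (.cov nab X (.app J (.cov nab Y Z)) - .cov nab Y (.app J (.cov nab X Z))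
    - .cov nab (.bracket X Y) (.app J Z)) (.app J W) x

/-- `R^J(Z̄_i, Z_j, Z_i, Z̄_j) = R(Z̄_i, Z_j, Z_i, Z̄_j)` for all complex fields of type `(1,0)`. -/
def ComplexCurvatureCondition
    (κ : BilinField E M) (J : EndField E M)
    (nab : CovariantDerivative 𝓘(ℝ, E) E (fun x : M ↦ TangentSpace 𝓘(ℝ, E) x)) : Prop :=
  ∀ Zi Zj : CVField E M, Zi.Smooth → Zj.Smooth → Zi.IsType10 J → Zj.IsType10 J → ∀ x,
    curvJC κ J nab Zi.conj Zj Zi Zj.conj x = curvC κ J nab Zi.conj Zj Zi Zj.conj x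

/-- `R^J(JX, Y, X, JY) = R(JX, Y, X, JY)` for all real vector fields. -/
def RealCurvatureCondition
    (κ : BilinField E M) (J : EndField E M)
    (nab : CovariantDerivative 𝓘(ℝ, E) E (fun x : M ↦ TangentSpace 𝓘(ℝ, E) x)) : Prop :=
  ∀ X Y : VField E M, SmoothVF X → SmoothVF Y → ∀ x,
    curvJ κ J nab (app J X) Y X (app J Y) x = curv κ J nab (app J X) Y X (app J Y) x

end AlmostKahler

end

/-! Both curvature conditions are equivalent to `∇J = 0`. Expanding `R^J - R` cancels the second
derivatives, so the difference is linear in `∇J` with first covariant derivatives as coefficients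
(`curvJ_sub_curv`). This uses that `∇J` is skew-adjoint, and that `dκ = 0` gives a cyclic identity
and `∇_{Jv} J = -J ∇_v J` (`covJ_J_left`).

Put `a = (∇_X J)Y` and `b = (∇_Y J)X`. Substituting `JX`, `JY` and using `∇(JY) = (∇J)Y + J∇Y`, the
coefficients cancel in suitable combinations, leaving quadratic expressions in `a` and `b`. The
complex condition gives `g(a, b) = 0`, hence `a = 0` by polarization. The real condition, summed
over four pairs, gives `|a|² + |b|² - g(a, b) = 0`, a definite form, so again `a = 0`. Conversely, a
parallel `J` commutes with `∇`, which yields `R^J = R` because `g` is Hermitian, and `N_J = 0`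
because `∇` is torsion-free. -/

namespace AlmostKahler

/-! ### Smooth vector fields and additivity of the connection. -/

section Smooth

variable {E : Type*} [NormedAddCommGroup E] [NormedSpace ℝ E]
  {M : Type*} [TopologicalSpace M] [ChartedSpace E M] [IsManifold 𝓘(ℝ, E) ∞ M]
  {J : EndField E M} {X Y : VField E M}

lemma SmoothVF.mdifferentiableAt (hX : SmoothVF X) (x : M) : MDiffAt (T% X) x :=
  (ContMDiff.mdifferentiable hX (by simp)) x

lemma SmoothVF.add (hX : SmoothVF X) (hY : SmoothVF Y) : SmoothVF (X + Y) :=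
  ContMDiff.add_section hX hY

lemma SmoothVF.neg (hX : SmoothVF X) : SmoothVF (-X) :=
  ContMDiff.neg_section hX

lemma IsAlmostComplex.smoothVF_app (hJ : IsAlmostComplex J) (hX : SmoothVF X) :
    SmoothVF (app J X) :=
  ContMDiff.clm_bundle_apply hJ.smooth hX

lemma IsAlmostComplex.app_app (hJ : IsAlmostComplex J) (X : VField E M) :
    app J (app J X) = -X := by
  ext x
  exact hJ.sq_eq_neg x (X x)

/-- Every tangent vector is the value of a smooth vector field. -/
lemma exists_smoothVF_eq [FiniteDimensional ℝ E] [T2Space M] {x : M}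
    (v : TangentSpace 𝓘(ℝ, E) x) : ∃ X : VField E M, SmoothVF X ∧ X x = v := by
  obtain ⟨s, hs, hsm⟩ := FiberBundle.exists_contMDiffOn_extend (k := ∞) 𝓘(ℝ, E) E v
  -- The local extension of `v` is cut off by a bump function whose closed support lies where the
  -- extension is smooth.
  obtain ⟨f, -, hf⟩ := (SmoothBumpFunction.nhds_basis_tsupport (I := 𝓘(ℝ, E)) x).mem_iff.1
    (interior_mem_nhds.2 hs)
  refine ⟨fun y ↦ f y • FiberBundle.extend E v y, ?_, by simp⟩
  exact ContMDiffOn.smul_section_of_tsupport f.contMDiff.contMDiffOn isOpen_interior hf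
    (hsm.mono interior_subset)

variable {nab : CovariantDerivative 𝓘(ℝ, E) E (fun x : M ↦ TangentSpace 𝓘(ℝ, E) x)}

lemma cov_add (X : VField E M) {Y Z : VField E M} (hY : SmoothVF Y) (hZ : SmoothVF Z) :
    cov nab X (Y + Z) = cov nab X Y + cov nab X Z := by
  ext x
  exact congr($(nab.isCovariantDerivativeOn.add (s := Set.univ) (hY.mdifferentiableAt x)
    (hZ.mdifferentiableAt x)) (X x))

lemma nab_neg_apply {Y : VField E M} (hY : SmoothVF Y) (x : M) :
    nab (-Y) x = -nab Y x := by
  have := nab.isCovariantDerivativeOn.smul_const (s := Set.univ) (-1) (hY.mdifferentiableAt x)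
  rwa [neg_one_smul, neg_one_smul] at this

lemma cov_neg (X : VField E M) {Y : VField E M} (hY : SmoothVF Y) :
    cov nab X (-Y) = -cov nab X Y := by
  ext x
  exact congr($(nab_neg_apply hY x) (X x))

lemma cov_sub (X : VField E M) {Y Z : VField E M} (hY : SmoothVF Y) (hZ : SmoothVF Z) :
    cov nab X (Y - Z) = cov nab X Y - cov nab X Z := by
  rw [sub_eq_add_neg, cov_add X hY hZ.neg, cov_neg X hZ, sub_eq_add_neg]

lemma cov_add_left (X Y Z : VField E M) : cov nab (X + Y) Z = cov nab X Z + cov nab Y Z := by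
  ext x; exact map_add (nab Z x) _ _

lemma cov_sub_left (X Y Z : VField E M) : cov nab (X - Y) Z = cov nab X Z - cov nab Y Z := by
  ext x; exact map_sub (nab Z x) _ _

lemma SmoothVF.cov [FiniteDimensional ℝ E] (h : nab.ContMDiffCovariantDerivative ∞)
    (hX : SmoothVF X) (hY : SmoothVF Y) : SmoothVF (cov nab X Y) := by
  have := h.contMDiff.contMDiff (σ := Y) (ContMDiff.contMDiffOn hY)
  exact ContMDiff.clm_bundle_apply (contMDiffOn_univ.1 this) hX

end Smooth

/-! ### Pointwise algebra of the Hermitian metric. -/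

section Metric

variable {E : Type*} [NormedAddCommGroup E] [NormedSpace ℝ E]
  {M : Type*} [TopologicalSpace M] [ChartedSpace E M]
  {κ : BilinField E M} {J : EndField E M} {x : M} (u v w : TangentSpace 𝓘(ℝ, E) x)

lemma app_add (X Y : VField E M) : app J (X + Y) = app J X + app J Y := by
  ext x; exact map_add (J x) _ _

lemma app_sub (X Y : VField E M) : app J (X - Y) = app J X - app J Y := by
  ext x; exact map_sub (J x) _ _

lemma app_neg (X : VField E M) : app J (-X) = -app J X := by
  ext x; exact map_neg (J x) _

lemma metric_add_left : metric κ J x (u + v) w = metric κ J x u w + metric κ J x v w := by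
  simp [metric]

lemma metric_sub_left : metric κ J x (u - v) w = metric κ J x u w - metric κ J x v w := by
  simp [metric]

lemma metric_neg_left : metric κ J x (-u) w = -metric κ J x u w := by
  simp [metric]

lemma metric_add_right : metric κ J x u (v + w) = metric κ J x u v + metric κ J x u w := by
  simp [metric]

lemma metric_sub_right : metric κ J x u (v - w) = metric κ J x u v - metric κ J x u w := by
  simp [metric]

lemma metric_neg_right : metric κ J x u (-w) = -metric κ J x u w := by
  simp [metric]

lemma metric_zero_left : metric κ J x 0 w = 0 := by
  simp [metric]

variable [IsManifold 𝓘(ℝ, E) ∞ M]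

lemma IsAlmostKahler.metric_J_left (hK : IsAlmostKahler κ J) :
    metric κ J x (J x u) w = -metric κ J x u (J x w) := by
  rw [← hK.hermitian x (J x u) w, hK.almostComplex.sq_eq_neg, metric_neg_left]

/-- Allows `κ` to be differentiated by metric compatibility. -/
lemma IsAlmostKahler.kappa_eq (hK : IsAlmostKahler κ J) : κ x v w = metric κ J x (J x v) w := by
  rw [hK.metric_J_left, metric, hK.almostComplex.sq_eq_neg, map_neg, neg_neg]

lemma IsAlmostKahler.eq_zero_of_metric_self (hK : IsAlmostKahler κ J) {v : TangentSpace 𝓘(ℝ, E) x}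
    (h : metric κ J x v v = 0) : v = 0 := by
  by_contra hv
  exact (hK.pos x v hv).ne' h

lemma IsAlmostKahler.metric_self_nonneg (hK : IsAlmostKahler κ J) : 0 ≤ metric κ J x v v := by
  by_cases hv : v = 0
  · simp [hv, metric_zero_left]
  · exact (hK.pos x v hv).le

lemma IsAlmostKahler.ext_metric (hK : IsAlmostKahler κ J) {v w : TangentSpace 𝓘(ℝ, E) x}
    (h : ∀ u, metric κ J x v u = metric κ J x w u) : v = w := by
  rw [← sub_eq_zero]
  apply hK.eq_zero_of_metric_self
  rw [metric_sub_left, h, sub_self]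

end Metric
-- The tensor `∇J` on an almost Kähler manifold.
section CovJ

variable {E : Type*} [NormedAddCommGroup E] [NormedSpace ℝ E]
  {M : Type*} [TopologicalSpace M] [ChartedSpace E M] [IsManifold 𝓘(ℝ, E) ∞ M]

/-- `(∇_v J) Y = ∇_v (J Y) - J ∇_v Y`. -/
noncomputable def covJ (J : EndField E M)
    (nab : CovariantDerivative 𝓘(ℝ, E) E (fun x : M ↦ TangentSpace 𝓘(ℝ, E) x))
    (x : M) (v : TangentSpace 𝓘(ℝ, E) x) (Y : VField E M) : TangentSpace 𝓘(ℝ, E) x :=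
  nab (app J Y) x v - J x (nab Y x v)

variable {κ : BilinField E M} {J : EndField E M}
  {nab : CovariantDerivative 𝓘(ℝ, E) E (fun x : M ↦ TangentSpace 𝓘(ℝ, E) x)}
  {x : M}

lemma nab_app (v : TangentSpace 𝓘(ℝ, E) x) (Y : VField E M) :
    nab (app J Y) x v = covJ J nab x v Y + J x (nab Y x v) := by
  simp [covJ]

lemma covJ_neg_left (v : TangentSpace 𝓘(ℝ, E) x) (Y : VField E M) :
    covJ J nab x (-v) Y = -covJ J nab x v Y := by
  simp only [covJ, map_neg]
  abel

lemma covJ_add_left (v w : TangentSpace 𝓘(ℝ, E) x) (Y : VField E M) :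
    covJ J nab x (v + w) Y = covJ J nab x v Y + covJ J nab x w Y := by
  simp only [covJ, map_add]
  abel

lemma covJ_add (hJ : IsAlmostComplex J) (v : TangentSpace 𝓘(ℝ, E) x) {Y Z : VField E M}
    (hY : SmoothVF Y) (hZ : SmoothVF Z) :
    covJ J nab x v (Y + Z) = covJ J nab x v Y + covJ J nab x v Z := by
  have h {A B : VField E M} (hA : SmoothVF A) (hB : SmoothVF B) : nab (A + B) x = _ :=
    nab.isCovariantDerivativeOn.add (s := Set.univ) (hA.mdifferentiableAt x)
      (hB.mdifferentiableAt x)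
  simp only [covJ, app_add, h hY hZ, h (hJ.smoothVF_app hY) (hJ.smoothVF_app hZ), add_apply,
    map_add]
  abel

lemma covJ_neg (hJ : IsAlmostComplex J) (v : TangentSpace 𝓘(ℝ, E) x) {Y : VField E M}
    (hY : SmoothVF Y) : covJ J nab x v (-Y) = -covJ J nab x v Y := by
  simp only [covJ, app_neg, nab_neg_apply hY, nab_neg_apply (hJ.smoothVF_app hY),
    neg_apply, map_neg]
  abel

/-- `∇J` anticommutes with `J`. -/
lemma covJ_app (hJ : IsAlmostComplex J) (v : TangentSpace 𝓘(ℝ, E) x) {Y : VField E M}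
    (hY : SmoothVF Y) : covJ J nab x v (app J Y) = -J x (covJ J nab x v Y) := by
  simp only [covJ, hJ.app_app, nab_neg_apply hY, neg_apply, map_sub, hJ.sq_eq_neg]
  abel

variable [FiniteDimensional ℝ E]

lemma IsLeviCivita.bracket_eq (hn : IsLeviCivita κ J nab) {X Y : VField E M} (hX : SmoothVF X)
    (hY : SmoothVF Y) (x : M) : bracket X Y x = nab Y x (X x) - nab X x (Y x) :=
  (nab.torsion_eq_zero_iff.1 hn.torsion_free (hX.mdifferentiableAt x)
    (hY.mdifferentiableAt x)).symm

lemma IsLeviCivita.smoothVF_cov (hn : IsLeviCivita κ J nab) {X Y : VField E M}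
    (hX : SmoothVF X) (hY : SmoothVF Y) : SmoothVF (cov nab X Y) :=
  hX.cov hn.smooth hY

variable [T2Space M]

/-- `∇J` is skew-adjoint. -/
lemma metric_covJ_left (hK : IsAlmostKahler κ J) (hn : IsLeviCivita κ J nab)
    (v : TangentSpace 𝓘(ℝ, E) x) {Y Z : VField E M} (hY : SmoothVF Y) (hZ : SmoothVF Z) :
    metric κ J x (covJ J nab x v Y) (Z x) = -metric κ J x (Y x) (covJ J nab x v Z) := by
  obtain ⟨X, -, rfl⟩ := exists_smoothVF_eq v
  have hJ := hK.almostComplex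
  have hZ' := (hJ.smoothVF_app hZ)
  have h₁ := hn.metric_compatible X (app J Y) Z x
    ((hJ.smoothVF_app hY).mdifferentiableAt x) (hZ.mdifferentiableAt x)
  have h₂ := hn.metric_compatible X Y (-app J Z) x (hY.mdifferentiableAt x)
    (hZ'.neg.mdifferentiableAt x)
  -- The function `g(JY, Z) = g(Y, -JZ)` is differentiated in both forms; the terms without `∇J`
  -- cancel.
  have h₃ : (fun y ↦ metric κ J y (app J Y y) (Z y)) =
      fun y ↦ metric κ J y (Y y) ((-app J Z) y) := by
    ext y
    rw [Pi.neg_apply, metric_neg_right]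
    exact hK.metric_J_left ..
  rw [h₃, h₂, cov_neg X hZ'] at h₁
  simp only [cov, nab_app, app, Pi.neg_apply, metric_add_left, metric_add_right,
    metric_neg_right, hK.metric_J_left] at h₁
  linarith

/-- The cyclic identity for `∇J`, equivalent to `dκ = 0`. -/
lemma metric_covJ_cyclic (hK : IsAlmostKahler κ J) (hn : IsLeviCivita κ J nab)
    (v : TangentSpace 𝓘(ℝ, E) x) {Y Z : VField E M} (hY : SmoothVF Y) (hZ : SmoothVF Z) :
    metric κ J x (covJ J nab x v Y) (Z x) =
      metric κ J x v (covJ J nab x (Z x) Y - covJ J nab x (Y x) Z) := by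
  obtain ⟨X, hX, rfl⟩ := exists_smoothVF_eq v
  have hJ := hK.almostComplex
  have hd := hK.symplectic.closed X Y Z hX hY hZ x
  have key : ∀ A B C : VField E M, SmoothVF A → SmoothVF B → SmoothVF C →
      mvfderiv 𝓘(ℝ, E) (fun y ↦ κ y (B y) (C y)) x (A x) =
        metric κ J x (nab (app J B) x (A x)) (C x) + metric κ J x (J x (B x)) (nab C x (A x)) := by
    intro A B C hA hB hC
    have := hn.metric_compatible A (app J B) C x ((hJ.smoothVF_app hB).mdifferentiableAt x)
      (hC.mdifferentiableAt x)
    rw [show (fun y ↦ κ y (B y) (C y)) = fun y ↦ metric κ J y (app J B y) (C y) from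
      funext fun y ↦ hK.kappa_eq ..]
    exact this
  -- With brackets written through `∇`, all derivatives of `X`, `Y`, `Z` cancel in `dκ`, leaving the
  -- cyclic sum of `∇J`.
  rw [extDeriv₂, key X Y Z hX hY hZ, key Y X Z hY hX hZ, key Z X Y hZ hX hY,
    hn.bracket_eq hX hY, hn.bracket_eq hX hZ, hn.bracket_eq hY hZ] at hd
  have s₁ := metric_covJ_left hK hn (Y x) hX hZ
  have s₂ := metric_covJ_left hK hn (Z x) hX hY
  simp only [hK.kappa_eq] at hd
  simp only [nab_app, map_sub, metric_add_left, metric_sub_left] at hd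
  rw [metric_sub_right]
  simp only [hK.metric_J_left] at hd
  have e : ∀ a b : TangentSpace 𝓘(ℝ, E) x, metric κ J x a (J x b) = - metric κ J x b (J x a) := by
    intro a b
    rw [← hK.metric_J_left, hK.symm]
  linarith [e (nab Z x (Y x)) (X x), e (nab Y x (Z x)) (X x), e (nab Z x (X x)) (Y x)]

/-- On an almost Kähler manifold, `∇_{Jv} J = -J ∇_v J`. -/
lemma covJ_J_left (hK : IsAlmostKahler κ J) (hn : IsLeviCivita κ J nab)
    (v : TangentSpace 𝓘(ℝ, E) x) {Y : VField E M} (hY : SmoothVF Y) :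
    covJ J nab x (J x v) Y = -J x (covJ J nab x v Y) := by
  have hJ := hK.almostComplex
  let T (X Y Z : VField E M) : ℝ := metric κ J x (covJ J nab x (X x) Y) (Z x)
  have skew : ∀ {X Y Z}, SmoothVF X → SmoothVF Y → SmoothVF Z → T X Y Z = -T X Z Y := by
    intro X Y Z hX hY hZ
    simp only [T]
    rw [metric_covJ_left hK hn _ hY hZ, hK.symm]
  have cyc : ∀ {X Y Z}, SmoothVF X → SmoothVF Y → SmoothVF Z →
      T X Y Z + T Y Z X + T Z X Y = 0 := by
    intro X Y Z hX hY hZ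
    have := metric_covJ_cyclic hK hn (X x) hY hZ
    rw [metric_sub_right, hK.symm x (X x), hK.symm x (X x)] at this
    have := skew hZ hX hY
    simp only [T] at *
    linarith
  have mid : ∀ {X Y Z}, SmoothVF X → SmoothVF Y → SmoothVF Z →
      T X (app J Y) Z = T X Y (app J Z) := by
    intro X Y Z hX hY hZ
    simp only [T]
    rw [covJ_app hJ _ hY, metric_neg_left, hK.metric_J_left, neg_neg]
    rfl
  -- `S` is the defect of the claim, paired with `Z`. It is cyclically invariant.
  let S (X Y Z : VField E M) : ℝ := T (app J X) Y Z - T X Y (app J Z)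
  have Scyc : ∀ {X Y Z}, SmoothVF X → SmoothVF Y → SmoothVF Z → S X Y Z = S Z X Y := by
    intro X Y Z hX hY hZ
    have h₁ := cyc (hJ.smoothVF_app hX) hY hZ
    have h₂ := cyc hX hY (hJ.smoothVF_app hZ)
    have h₃ := mid hY hZ hX
    have h₄ := mid hZ hX hY
    simp only [S]
    linarith
  have SJ : ∀ {X Y Z}, SmoothVF X → SmoothVF Y → SmoothVF Z →
      S (app J X) Y Z = -S X Y (app J Z) := by
    intro X Y Z hX hY hZ
    simp only [S, hJ.app_app]
    simp only [T, Pi.neg_apply, covJ_neg_left, metric_neg_left, metric_neg_right]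
    ring
  have Smid : ∀ {X Y Z}, SmoothVF X → SmoothVF Y → SmoothVF Z →
      S X (app J Y) Z = S X Y (app J Z) := by
    intro X Y Z hX hY hZ
    simp only [S]
    rw [mid (hJ.smoothVF_app hX) hY hZ, mid hX hY (hJ.smoothVF_app hZ)]
  -- Cyclicity and `Smid` carry `J` from the first slot to the last without a sign, while `SJ` does
  -- so with a minus sign.
  have S0 : ∀ {X Y Z}, SmoothVF X → SmoothVF Y → SmoothVF Z → S X Y (app J Z) = 0 := by
    intro X Y Z hX hY hZ
    have hX' := hJ.smoothVF_app hX
    have hZ' := hJ.smoothVF_app hZ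
    linarith [SJ hX hY hZ, Scyc (hJ.smoothVF_app hX) hY hZ, Smid hZ hX hY,
      Scyc hX (hJ.smoothVF_app hY) hZ, Smid hX hY hZ]
  obtain ⟨X, hX, rfl⟩ := exists_smoothVF_eq v
  refine hK.ext_metric fun w ↦ ?_
  obtain ⟨Z, hZ, rfl⟩ := exists_smoothVF_eq w
  have h := S0 hX hY (hJ.smoothVF_app hZ)
  simp only [S, hJ.app_app] at h
  simp only [T, Pi.neg_apply, metric_neg_right, app, map_neg] at h
  rw [metric_neg_left, hK.metric_J_left, neg_neg]
  linarith

/-- `g((R^J - R)(X,Y)Z, W)` in terms of `∇J`. -/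
lemma curvJ_sub_curv (hK : IsAlmostKahler κ J) (hn : IsLeviCivita κ J nab)
    {X Y Z W : VField E M} (hX : SmoothVF X) (hY : SmoothVF Y) (hZ : SmoothVF Z)
    (hW : SmoothVF W) (x : M) :
    curvJ κ J nab X Y Z W x - curv κ J nab X Y Z W x =
      metric κ J x (nab Z x (Y x)) (J x (covJ J nab x (X x) W))
        - metric κ J x (nab Z x (X x)) (J x (covJ J nab x (Y x) W))
        + metric κ J x (nab Y x (X x) - nab X x (Y x))
          (J x (covJ J nab x (W x) Z) - J x (covJ J nab x (Z x) W)) := by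
  have hJ := hK.almostComplex
  have hW' := hJ.smoothVF_app hW
  have h₁ := metric_covJ_left hK hn (X x) (hn.smoothVF_cov hY hZ) hW'
  have h₂ := metric_covJ_left hK hn (Y x) (hn.smoothVF_cov hX hZ) hW'
  -- The cyclic identity moves the bracket out of the direction slot of `∇J`, so that it too becomes
  -- a coefficient.
  have h₃ := metric_covJ_cyclic hK hn (bracket X Y x) hZ hW'
  rw [covJ_app hJ _ hW, metric_neg_right, neg_neg] at h₁ h₂
  rw [covJ_app hJ _ hW, show app J W x = J x (W x) from rfl, covJ_J_left hK hn _ hZ,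
    hn.bracket_eq hX hY, metric_sub_right, metric_neg_right, metric_neg_right] at h₃
  rw [← hn.bracket_eq hX hY] at h₃ ⊢
  simp only [cov, app] at h₁ h₂
  -- Commuting `J` past the outer derivatives leaves `J` applied to the curvature; Hermitian
  -- symmetry then turns its pairing with `JW` into `R`.
  have key : (cov nab X (app J (cov nab Y Z)) - cov nab Y (app J (cov nab X Z))
      - cov nab (bracket X Y) (app J Z)) x =
      covJ J nab x (X x) (cov nab Y Z) - covJ J nab x (Y x) (cov nab X Z)
        - covJ J nab x (bracket X Y x) Z
        + J x ((cov nab X (cov nab Y Z) - cov nab Y (cov nab X Z)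
          - cov nab (bracket X Y) Z) x) := by
    simp only [cov, Pi.sub_apply, nab_app, map_sub]
    abel
  rw [curvJ, curv, key, metric_add_left, show app J W x = J x (W x) from rfl, hK.hermitian,
    metric_sub_left, metric_sub_left, metric_sub_right]
  linarith

end CovJ
-- Real parts of the complex curvature expressions.
section ComplexFields

variable {E : Type*} [NormedAddCommGroup E] [NormedSpace ℝ E]
  {M : Type*} [TopologicalSpace M] [ChartedSpace E M]

lemma CVField.re_sub (Z W : CVField E M) : (Z - W).re = Z.re - W.re := rfl

lemma CVField.im_sub (Z W : CVField E M) : (Z - W).im = Z.im - W.im := rfl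

/-- `X - iJX` is of type `(1,0)`. -/
lemma isType10_mk [IsManifold 𝓘(ℝ, E) ∞ M] {J : EndField E M} (hJ : IsAlmostComplex J)
    (X : VField E M) : (CVField.mk X (-app J X)).IsType10 J := by
  ext x
  · change J x (X x) = (0 : ℝ) • X x - (1 : ℝ) • (-J x (X x))
    simp
  · change J x (-J x (X x)) = (0 : ℝ) • (-J x (X x)) + (1 : ℝ) • X x
    simp [hJ.sq_eq_neg]

variable [FiniteDimensional ℝ E] [IsManifold 𝓘(ℝ, E) ∞ M]
  {κ : BilinField E M} {J : EndField E M}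
  {nab : CovariantDerivative 𝓘(ℝ, E) E (fun x : M ↦ TangentSpace 𝓘(ℝ, E) x)}

/-- The real part of the complex-multilinear extension of `R`. -/
lemma curvC_re (hn : IsLeviCivita κ J nab) {X X' Y Y' Z Z' : VField E M}
    (hX : SmoothVF X) (hX' : SmoothVF X') (hY : SmoothVF Y) (hY' : SmoothVF Y')
    (hZ : SmoothVF Z) (hZ' : SmoothVF Z') (W W' : VField E M) (x : M) :
    (curvC κ J nab ⟨X, X'⟩ ⟨Y, Y'⟩ ⟨Z, Z'⟩ ⟨W, W'⟩ x).re =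
      curv κ J nab X Y Z W x - curv κ J nab X' Y' Z W x - curv κ J nab X' Y Z' W x
        - curv κ J nab X Y' Z' W x - curv κ J nab X' Y Z W' x - curv κ J nab X Y' Z W' x
        - curv κ J nab X Y Z' W' x + curv κ J nab X' Y' Z' W' x := by
  have hc {A B : VField E M} (hA : SmoothVF A) (hB : SmoothVF B) := hn.smoothVF_cov hA hB
  simp only [curvC, gC, CVField.cov, CVField.bracket, CVField.re_sub, CVField.im_sub,
    cov_sub, cov_add, cov_sub_left, cov_add_left, hX, hX', hY, hY', hZ, hZ', hc, curv,
    Pi.sub_apply, Pi.add_apply, metric_sub_left, metric_add_left]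
  ring

/-- The real part of the complex-multilinear extension of `R^J`. -/
lemma curvJC_re (hJ : IsAlmostComplex J) (hn : IsLeviCivita κ J nab) {X X' Y Y' Z Z' : VField E M}
    (hX : SmoothVF X) (hX' : SmoothVF X') (hY : SmoothVF Y) (hY' : SmoothVF Y')
    (hZ : SmoothVF Z) (hZ' : SmoothVF Z') (W W' : VField E M) (x : M) :
    (curvJC κ J nab ⟨X, X'⟩ ⟨Y, Y'⟩ ⟨Z, Z'⟩ ⟨W, W'⟩ x).re =
      curvJ κ J nab X Y Z W x - curvJ κ J nab X' Y' Z W x - curvJ κ J nab X' Y Z' W x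
        - curvJ κ J nab X Y' Z' W x - curvJ κ J nab X' Y Z W' x - curvJ κ J nab X Y' Z W' x
        - curvJ κ J nab X Y Z' W' x + curvJ κ J nab X' Y' Z' W' x := by
  have hc {A B : VField E M} (hA : SmoothVF A) (hB : SmoothVF B) := hn.smoothVF_cov hA hB
  have ha {A : VField E M} (hA : SmoothVF A) := hJ.smoothVF_app hA
  simp (maxDischargeDepth := 6) only [curvJC, gC, CVField.cov, CVField.bracket, CVField.app,
    CVField.re_sub, CVField.im_sub, app_sub, app_add,
    cov_sub, cov_add, cov_sub_left, cov_add_left, hX, hX', hY, hY', hZ, hZ', hc, ha, curvJ,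
    Pi.sub_apply, Pi.add_apply, metric_sub_left, metric_add_left]
  ring

end ComplexFields

/-! ### Vanishing of `∇J` from either curvature condition. -/

section Rigidity

variable {E : Type*} [NormedAddCommGroup E] [NormedSpace ℝ E] [FiniteDimensional ℝ E]
  {M : Type*} [TopologicalSpace M] [T2Space M] [ChartedSpace E M] [IsManifold 𝓘(ℝ, E) ∞ M]
  {κ : BilinField E M} {J : EndField E M}
  {nab : CovariantDerivative 𝓘(ℝ, E) E (fun x : M ↦ TangentSpace 𝓘(ℝ, E) x)}

/-- The sum of `(R^J - R)(JX, Y, X, JY)` over the pairs `(X, Y)`, `(JX, Y)`, `(X, JY)`, `(JX, JY)`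
is a negative definite form in `∇J`. -/
lemma sum_curvJ_sub_curv (hK : IsAlmostKahler κ J) (hn : IsLeviCivita κ J nab)
    {X Y : VField E M} (hX : SmoothVF X) (hY : SmoothVF Y) (x : M)
    {Q : VField E M → VField E M → ℝ}
    (hQ : ∀ X Y, Q X Y = curvJ κ J nab (app J X) Y X (app J Y) x
      - curv κ J nab (app J X) Y X (app J Y) x) :
    Q X Y + Q (app J X) Y + Q X (app J Y) + Q (app J X) (app J Y) =
      -2 * (metric κ J x (covJ J nab x (X x) Y) (covJ J nab x (X x) Y)
        + metric κ J x (covJ J nab x (Y x) X) (covJ J nab x (Y x) X)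
        - metric κ J x (covJ J nab x (X x) Y) (covJ J nab x (Y x) X)) := by
  have hJ := hK.almostComplex
  have ha {A : VField E M} (hA : SmoothVF A) := hJ.smoothVF_app hA
  have happ (A : VField E M) : app J A x = J x (A x) := rfl
  simp (maxDischargeDepth := 6) only [hQ, curvJ_sub_curv hK hn, hX, hY, ha, nab_app, covJ_app hJ,
    covJ_J_left hK hn, happ,
    map_neg, map_add, hJ.sq_eq_neg, metric_add_left, metric_sub_left, metric_neg_left,
    metric_sub_right, metric_neg_right, hK.metric_J_left,
    covJ_neg_left]
  set a := covJ J nab x (X x) Y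
  set b := covJ J nab x (Y x) X
  have e (u v : TangentSpace 𝓘(ℝ, E) x) :
      metric κ J x u (J x v) = - metric κ J x v (J x u) := by
    rw [← hK.metric_J_left, hK.symm]
  linarith [hK.symm x a b, e a b, e a a, e b b]

/-- The real part of `(R^J - R)(Z̄, W, Z, W̄)` for `Z = X - iJX` and `W = Y - iJY`. -/
lemma re_curvJC_sub_re_curvC (hK : IsAlmostKahler κ J) (hn : IsLeviCivita κ J nab)
    {X Y : VField E M} (hX : SmoothVF X) (hY : SmoothVF Y) (x : M) :
    (curvJC κ J nab ⟨X, app J X⟩ ⟨Y, -app J Y⟩ ⟨X, -app J X⟩ ⟨Y, app J Y⟩ x).re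
      - (curvC κ J nab ⟨X, app J X⟩ ⟨Y, -app J Y⟩ ⟨X, -app J X⟩ ⟨Y, app J Y⟩ x).re =
      4 * metric κ J x (covJ J nab x (X x) Y) (covJ J nab x (Y x) X) := by
  have hJ := hK.almostComplex
  have ha {A : VField E M} (hA : SmoothVF A) := hJ.smoothVF_app hA
  have hm {A : VField E M} (hA : SmoothVF A) := hA.neg
  have happ (A : VField E M) : app J A x = J x (A x) := rfl
  rw [curvJC_re hJ hn hX (ha hX) hY (hm (ha hY)) hX (hm (ha hX)),
    curvC_re hn hX (ha hX) hY (hm (ha hY)) hX (hm (ha hX))]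
  -- Pairs each `R^J` term with its `R` term, so that `curvJ_sub_curv` applies to every difference.
  have regroup {a b c d e f g h a' b' c' d' e' f' g' h' : ℝ} :
      a - b - c - d - e - f - g + h - (a' - b' - c' - d' - e' - f' - g' + h') =
      (a - a') - (b - b') - (c - c') - (d - d') - (e - e') - (f - f') - (g - g') + (h - h') := by
    ring
  rw [regroup]
  simp (maxDischargeDepth := 6) only [curvJ_sub_curv hK hn, hX, hY, ha, hm]
  simp (maxDischargeDepth := 6) only [nab_neg_apply, covJ_neg hJ, hX, hY, ha, nab_app, covJ_app hJ,
    covJ_J_left hK hn, happ, Pi.neg_apply,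
    map_neg, hJ.sq_eq_neg, metric_add_left, metric_sub_left, metric_neg_left,
    metric_sub_right, metric_neg_right, hK.metric_J_left, neg_apply,
    covJ_neg_left]
  set a := covJ J nab x (X x) Y
  set b := covJ J nab x (Y x) X
  have e (u v : TangentSpace 𝓘(ℝ, E) x) :
      metric κ J x u (J x v) = - metric κ J x v (J x u) := by
    rw [← hK.metric_J_left, hK.symm]
  linarith [hK.symm x a b, e a b, e a a, e b b]

/-- The complex curvature condition forces `∇J = 0`. -/
lemma ComplexCurvatureCondition.covJ_eq_zero (hK : IsAlmostKahler κ J)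
    (hn : IsLeviCivita κ J nab) (h : ComplexCurvatureCondition κ J nab) {x : M}
    (v : TangentSpace 𝓘(ℝ, E) x) {Y : VField E M} (hY : SmoothVF Y) :
    covJ J nab x v Y = 0 := by
  have hJ := hK.almostComplex
  obtain ⟨X, hX, rfl⟩ := exists_smoothVF_eq v
  have orth {X Y : VField E M} (hX : SmoothVF X) (hY : SmoothVF Y) :
      metric κ J x (covJ J nab x (X x) Y) (covJ J nab x (Y x) X) = 0 := by
    have := h ⟨X, -app J X⟩ ⟨Y, -app J Y⟩ ⟨hX, (hJ.smoothVF_app hX).neg⟩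
      ⟨hY, (hJ.smoothVF_app hY).neg⟩ (isType10_mk hJ X) (isType10_mk hJ Y) x
    simp only [CVField.conj, neg_neg] at this
    have h' := re_curvJC_sub_re_curvC hK hn hX hY x
    rw [this] at h'
    linarith
  have self {X : VField E M} (hX : SmoothVF X) : covJ J nab x (X x) X = 0 :=
    hK.eq_zero_of_metric_self (orth hX hX)
  -- Polarization of `(∇_X J)X = 0` at `X + Y`.
  have hadd : covJ J nab x (Y x) X = -covJ J nab x (X x) Y := by
    have h₁ := self (hX.add hY)
    have h₂ := self hX
    have h₃ := self hY
    rw [Pi.add_apply, covJ_add hJ _ hX hY, covJ_add_left, covJ_add_left, h₂, h₃] at h₁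
    simpa using eq_neg_of_add_eq_zero_left (by simpa using h₁)
  have := orth hX hY
  rw [hadd, metric_neg_right, neg_eq_zero] at this
  exact hK.eq_zero_of_metric_self this

/-- The real curvature condition forces `∇J = 0`. -/
lemma RealCurvatureCondition.covJ_eq_zero (hK : IsAlmostKahler κ J)
    (hn : IsLeviCivita κ J nab) (h : RealCurvatureCondition κ J nab) {x : M}
    (v : TangentSpace 𝓘(ℝ, E) x) {Y : VField E M} (hY : SmoothVF Y) :
    covJ J nab x v Y = 0 := by
  have hJ := hK.almostComplex
  obtain ⟨X, hX, rfl⟩ := exists_smoothVF_eq v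
  have hX' := hJ.smoothVF_app hX
  have hY' := hJ.smoothVF_app hY
  have hs := sum_curvJ_sub_curv hK hn hX hY x fun _ _ ↦ rfl
  simp only [h _ _ hX hY, h _ _ hX' hY, h _ _ hX hY', h _ _ hX' hY', sub_self] at hs
  set a := covJ J nab x (X x) Y
  set b := covJ J nab x (Y x) X
  -- Definiteness comes from `2(|a|² + |b|² - g(a, b)) = |a|² + |b|² + |a - b|²`.
  have h₁ := hK.metric_self_nonneg (a - b)
  have h₂ := hK.metric_self_nonneg a
  have h₃ := hK.metric_self_nonneg b
  rw [metric_sub_left, metric_sub_right, metric_sub_right, hK.symm x b a] at h₁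
  apply hK.eq_zero_of_metric_self
  linarith

end Rigidity

/-! ### Consequences of a parallel `J`. -/

section Parallel

variable {E : Type*} [NormedAddCommGroup E] [NormedSpace ℝ E]
  {M : Type*} [TopologicalSpace M] [ChartedSpace E M] [IsManifold 𝓘(ℝ, E) ∞ M]
  {κ : BilinField E M} {J : EndField E M}
  {nab : CovariantDerivative 𝓘(ℝ, E) E (fun x : M ↦ TangentSpace 𝓘(ℝ, E) x)}

lemma cov_app_of_covJ_eq_zero
    (h : ∀ x v {Y : VField E M}, SmoothVF Y → covJ J nab x v Y = 0)
    (X : VField E M) {Y : VField E M} (hY : SmoothVF Y) :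
    cov nab X (app J Y) = app J (cov nab X Y) :=
  funext fun x ↦ sub_eq_zero.1 (h x (X x) hY)

variable [FiniteDimensional ℝ E]

/-- If `∇J = 0`, then `J` is integrable. -/
lemma isIntegrable_of_covJ_eq_zero (hJ : IsAlmostComplex J) (hn : IsLeviCivita κ J nab)
    (h : ∀ x v {Y : VField E M}, SmoothVF Y → covJ J nab x v Y = 0) : IsIntegrable J := by
  intro X Y hX hY x
  have hX' := hJ.smoothVF_app hX
  have hY' := hJ.smoothVF_app hY
  simp only [nijenhuis, Pi.sub_apply]
  rw [app, app, hn.bracket_eq hX hY, hn.bracket_eq hX' hY', hn.bracket_eq hX' hY,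
    hn.bracket_eq hX hY']
  simp only [nab_app, h _ _ hX, h _ _ hY, zero_add, map_sub, app, hJ.sq_eq_neg]
  abel

/-- If `∇J = 0`, then `R^J = R` for complex vector fields. -/
lemma curvJC_eq_curvC_of_covJ_eq_zero (hK : IsAlmostKahler κ J) (hn : IsLeviCivita κ J nab)
    (h : ∀ x v {Y : VField E M}, SmoothVF Y → covJ J nab x v Y = 0)
    {X Y Z : CVField E M} (hX : X.Smooth) (hY : Y.Smooth) (hZ : Z.Smooth) (W : CVField E M)
    (x : M) : curvJC κ J nab X Y Z W x = curvC κ J nab X Y Z W x := by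
  have hc {A B : VField E M} (hA : SmoothVF A) (hB : SmoothVF B) := hn.smoothVF_cov hA hB
  have hJ := hK.almostComplex
  have key : CVField.cov nab X (.app J (.cov nab Y Z)) - .cov nab Y (.app J (.cov nab X Z))
      - .cov nab (.bracket X Y) (.app J Z) = CVField.app J (.cov nab X (.cov nab Y Z)
      - .cov nab Y (.cov nab X Z) - .cov nab (.bracket X Y) Z) := by
    ext1 <;>
    simp (maxDischargeDepth := 6) only [CVField.cov, CVField.app, CVField.re_sub,
      CVField.im_sub, app_sub, app_add, cov_sub, cov_add, hJ.smoothVF_app, cov_app_of_covJ_eq_zero h,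
      hX.1, hX.2, hY.1, hY.2, hZ.1, hZ.2, hc]
  rw [curvJC, curvC, key]
  simp only [gC, CVField.app, app, hK.hermitian]

/-- If `∇J = 0`, then `R^J = R`. -/
lemma curvJ_eq_curv_of_covJ_eq_zero (hK : IsAlmostKahler κ J) (hn : IsLeviCivita κ J nab)
    (h : ∀ x v {Y : VField E M}, SmoothVF Y → covJ J nab x v Y = 0)
    {X Y Z : VField E M} (hX : SmoothVF X) (hY : SmoothVF Y) (hZ : SmoothVF Z) (W : VField E M)
    (x : M) : curvJ κ J nab X Y Z W x = curv κ J nab X Y Z W x := by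
  have hc {A B : VField E M} (hA : SmoothVF A) (hB : SmoothVF B) := hn.smoothVF_cov hA hB
  simp only [curvJ, curv, cov_app_of_covJ_eq_zero h, hX, hY, hZ, hc, ← app_sub]
  exact hK.hermitian ..

end Parallel
end AlmostKahler

theorem theorem4p2
    {E : Type*} [NormedAddCommGroup E] [NormedSpace ℝ E] [FiniteDimensional ℝ E]
    {M : Type*} [TopologicalSpace M] [T2Space M] [ChartedSpace E M] [IsManifold 𝓘(ℝ, E) ∞ M]
    (κ : AlmostKahler.BilinField E M) (J : AlmostKahler.EndField E M)
    (hK : AlmostKahler.IsAlmostKahler κ J)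
    (nab : CovariantDerivative 𝓘(ℝ, E) E (fun x : M ↦ TangentSpace 𝓘(ℝ, E) x))
    (hnab : AlmostKahler.IsLeviCivita κ J nab) :
    (AlmostKahler.ComplexCurvatureCondition κ J nab → AlmostKahler.IsIntegrable J) ∧
      (AlmostKahler.ComplexCurvatureCondition κ J nab ↔
        AlmostKahler.RealCurvatureCondition κ J nab) := by
  have hJ := hK.almostComplex
  -- All three implications pass through `∇J = 0`.
  refine ⟨fun h ↦ AlmostKahler.isIntegrable_of_covJ_eq_zero hJ hnab
    fun _ v _ hY ↦ h.covJ_eq_zero hK hnab v hY, fun h X Y hX hY x ↦ ?_,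
    fun h Zi Zj hi hj _ _ x ↦ ?_⟩
  · exact AlmostKahler.curvJ_eq_curv_of_covJ_eq_zero hK hnab
      (fun _ v _ hY ↦ h.covJ_eq_zero hK hnab v hY) (hJ.smoothVF_app hX) hY hX _ x
  · exact AlmostKahler.curvJC_eq_curvC_of_covJ_eq_zero hK hnab
      (fun _ v _ hY ↦ h.covJ_eq_zero hK hnab v hY) (X := Zi.conj) ⟨hi.1, hi.2.neg⟩ hj hi _ x
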